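/- **Theorem (Continuity theorem).** Let $\Gamma$ be a finitely generated group that is virtually $(\mathcal H,F)$-indicable: $\mathcal H\trianglelefteq\Gamma$ is a normal subgroup of finite index and $F:\mathcal H\to\mathbb Z$ is a surjective homomorphism. *Weights and walks.* A self-avoiding walk (SAW) is a finite sequence $\pi=(\pi_0,\dots,\pi_n)$ of distinct elements of $\Gamma$. For functions $\phi,\ell$ on $\Gamma$, put $w_\phi(\pi)=\prod_{i=1}^n\phi(\pi_{i-1}^{-1}\pi_i)$ and $\ell(\pi)=\sum_{i=1}^n\ell(\pi_{i-1}^{-1}\pi_i)$. Let $\Phi$ be the set of weight functions, that is, of functions $\phi:\Gamma\to[0,\infty)$ with $\phi(\mathbf 1)=0$, $\phi(\gamma^{-1})=\phi(\gamma)$ for all $\gamma$, and $\sum_\gamma\phi(\gamma)<\infty$, such that any two elements of $\Gamma$ are joined by a SAW $\pi$ with $w_\phi(\pi)>0$. Write $\mathrm{supp}(\phi)=\{\gamma:\phi(\gamma)>0\}$, and let $K_\phi$ be the Cayley graph on $\Gamma$ in which $u,v$ are neighbours when $u^{-1}v\in\mathrm{supp}(\phi)$. Let $\Lambda$ be the set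 of functions $\ell:\Gamma\to(0,\infty)$ with $\ell(\gamma^{-1})=\ell(\gamma)$ for all $\gamma$ and $\inf_\gamma\ell(\gamma)>0$. *Connective constant.* For $\phi\in\Phi$, $\ell\in\Lambda$, let $\sigma_{m,c}$ be the set of SAWs $\pi$ with $\pi_0=\mathbf 1$ and $m\le\ell(\pi)<m+c$, and let $$\mu_{\phi,\ell}=\limsup_{m\to\infty}\Bigl(\sum_{\pi\in\sigma_{m,c}}w_\phi(\pi)\Bigr)^{1/m},$$ where $m$ runs through the integers; the value is the same for all sufficiently large $c$. *Height functions.* For each $\phi\in\Phi$ let $(h_\phi,\mathcal H)$ be a strong graph height function on $K_\phi$, that is, $h_\phi:\Gamma\to\mathbb Z$ satisfies $h_\phi(\mathbf 1)=0$; $h_\phi(\alpha v)-h_\phi(\alpha u)=h_\phi(v)-h_\phi(u)$ for $\alpha\in\mathcal H$ and $u,v\in\Gamma$; and each $v\in\Gamma$ has neighbours $u,w$ in $K_\phi$ with $h_\phi(u)<h_\phi(v)<h_\phi(w)$. The choice of $h_\phi$ is arbitrary. *The space.* Let $C,W>0$ and $\varepsilon\in[1,2)$. Let $\Lambda_\varepsilon(C,\phi)$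 be the set of $\ell\in\Lambda$ such that $$|h_\phi(u)-h_\phi(v)|\le C\,\ell(u^{-1}v)^{\varepsilon}\qquad\text{for all }u,v\in\Gamma\text{ with }\phi(u^{-1}v)>0,$$ and let $\Phi\circ\Lambda_\varepsilon(C,W)$ be the set of pairs $(\phi,\ell)$ with $\phi\in\Phi$, $\ell\in\Lambda_\varepsilon(C,\phi)$ and $\mu_{\phi,\ell}\le W$. On this set define $$D_{\sup}\bigl((\phi,\ell_1),(\psi,\ell_2)\bigr)=\sup_\gamma\left|\frac{\phi(\gamma)-\psi(\gamma)}{\phi(\gamma)+\psi(\gamma)}\right|+\sup_\gamma\left|\frac{\ell_1(\gamma)-\ell_2(\gamma)}{\ell_1(\gamma)+\ell_2(\gamma)}\right|,$$ where the suprema are over $\gamma\in\mathrm{supp}(\phi)\cup\mathrm{supp}(\psi)$. *Conclusion.* The connective constant $\mu$ is continuous on $\Phi\circ\Lambda_\varepsilon(C,W)$ with respect to $D_{\sup}$: for every $(\phi,\ell_1)\in\Phi\circ\Lambda_\varepsilon(C,W)$ and every $\rho>0$ there is $\delta>0$ such that $|\mu_{\phi,\ell_1}-\mu_{\psi,\ell_2}|<\rho$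 for all $(\psi,\ell_2)\in\Phi\circ\Lambda_\varepsilon(C,W)$ with $D_{\sup}\bigl((\phi,\ell_1),(\psi,\ell_2)\bigr)<\delta$. -/

import Mathlib

open Filter

noncomputable section

namespace WeightedSAW

/-- `Γ` is virtually `(H, F)`-indicable: `H` is a normal subgroup of finite index and
`F : H → ℤ` is a surjective homomorphism. -/
structure IsVirtuallyIndicable {Γ : Type*} [Group Γ] (H : Subgroup Γ)
    (F : H →* Multiplicative ℤ) : Prop where
  normal : H.Normal
  finiteIndex : H.FiniteIndex
  surjective : Function.Surjective F

/-- A (finite) self-avoiding walk on the complete graph with vertex set `Γ`: a sequence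
`π₀, π₁, …, πₙ` of distinct vertices. -/
structure SAW (Γ : Type*) where
  steps : ℕ
  vertex : Fin (steps + 1) → Γ
  injective : Function.Injective vertex

namespace SAW

variable {Γ : Type*} [Group Γ]

/-- The group element `πᵢ₋₁⁻¹ πᵢ` labelling the `i`-th edge of the walk. -/
def increment (π : SAW Γ) (i : Fin π.steps) : Γ :=
  (π.vertex i.castSucc)⁻¹ * π.vertex i.succ

/-- The weight `w_φ(π) = ∏ φ(πᵢ₋₁⁻¹ πᵢ)`. -/
def weight (φ : Γ → ℝ) (π : SAW Γ) : ℝ :=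
  ∏ i, φ (π.increment i)

/-- The length `ℓ(π) = ∑ ℓ(πᵢ₋₁⁻¹ πᵢ)`. -/
def length (ℓ : Γ → ℝ) (π : SAW Γ) : ℝ :=
  ∑ i, ℓ (π.increment i)

end SAW

/-- `φ` spans `Γ`: any two elements are joined by a SAW of strictly positive weight. -/
def Spans {Γ : Type*} [Group Γ] (φ : Γ → ℝ) : Prop :=
  ∀ η γ : Γ, ∃ π : SAW Γ,
    π.vertex 0 = η ∧ π.vertex (Fin.last π.steps) = γ ∧ 0 < π.weight φ

/-- A weight function on `Γ`: an element of `Φ`. -/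
structure IsWeightFunction {Γ : Type*} [Group Γ] (φ : Γ → ℝ) : Prop where
  nonneg : ∀ γ, 0 ≤ φ γ
  map_one : φ 1 = 0
  symmetric : ∀ γ, φ γ⁻¹ = φ γ
  summable : Summable φ
  spans : Spans φ

/-- A length function on `Γ`: an element of `Λ`. -/
structure IsLengthFunction {Γ : Type*} [Group Γ] (ℓ : Γ → ℝ) : Prop where
  pos : ∀ γ, 0 < ℓ γ
  symmetric : ∀ γ, ℓ γ⁻¹ = ℓ γ
  iInf_pos : 0 < ⨅ γ, ℓ γ

/-- `(h, H)` is a strong graph height function on the Cayley graph `K_φ` of `Γ`, in which `u` and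
`v` are neighbours when `φ (u⁻¹ v) > 0`, and on which `H` acts by left multiplication. -/
structure IsStrongGraphHeight {Γ : Type*} [Group Γ] (φ : Γ → ℝ) (H : Subgroup Γ)
    (h : Γ → ℤ) : Prop where
  normal : H.Normal
  finiteIndex : H.FiniteIndex
  map_one : h 1 = 0
  diff_invariant : ∀ α ∈ H, ∀ u v : Γ, h (α * v) - h (α * u) = h v - h u
  exists_neighbours : ∀ v : Γ, ∃ u w : Γ,
    0 < φ (v⁻¹ * u) ∧ 0 < φ (v⁻¹ * w) ∧ h u < h v ∧ h v < h w

/-- The set `σ_{m,c}` of SAWs from the identity with `ℓ`-length in `[m, m + c)`. -/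
def sawWindow {Γ : Type*} [Group Γ] (ℓ : Γ → ℝ) (m c : ℝ) : Set (SAW Γ) :=
  {π | π.vertex 0 = 1 ∧ m ≤ π.length ℓ ∧ π.length ℓ < m + c}

/-- The total weight `w_φ(Π)` of a set `Π` of SAWs. -/
def totalWeight {Γ : Type*} [Group Γ] (φ : Γ → ℝ) (P : Set (SAW Γ)) : ENNReal :=
  ∑' π : P, ENNReal.ofReal (π.1.weight φ)

/-- `limsup_{m → ∞} w_φ(σ_{m,c})^{1/m}`, with `m` running through the integers. -/
def windowGrowth {Γ : Type*} [Group Γ] (φ ℓ : Γ → ℝ) (c : ℝ) : ENNReal :=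
  limsup (fun m : ℕ => totalWeight φ (sawWindow ℓ m c) ^ (1 / (m : ℝ))) atTop

/-- The connective constant `μ_{φ,ℓ}`: the common value of `windowGrowth φ ℓ c` for all
sufficiently large `c` (see `windowGrowth_eq_connectiveConstant`). -/
def connectiveConstant {Γ : Type*} [Group Γ] (φ ℓ : Γ → ℝ) : ENNReal :=
  limsup (fun c : ℝ => windowGrowth φ ℓ c) atTop

/-- The set `Λ_ε(C, φ)` of length functions satisfying the Hölder condition for the height
function `h`. -/
def holderLengths {Γ : Type*} [Group Γ] (h : Γ → ℤ) (ε C : ℝ) (φ : Γ → ℝ) : Set (Γ → ℝ) :=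
  {ℓ | IsLengthFunction ℓ ∧
    ∀ u v : Γ, 0 < φ (u⁻¹ * v) → |(h u : ℝ) - (h v : ℝ)| ≤ C * ℓ (u⁻¹ * v) ^ ε}

/-- The space `Φ ∘ Λ_ε(C, W)` of pairs `(φ, ℓ)`; here `h φ` is the height function chosen on the
Cayley graph `K_φ`. -/
def pairSpace {Γ : Type*} [Group Γ] (h : (Γ → ℝ) → Γ → ℤ) (ε C W : ℝ) :
    Set ((Γ → ℝ) × (Γ → ℝ)) :=
  {x | IsWeightFunction x.1 ∧ x.2 ∈ holderLengths (h x.1) ε C x.1 ∧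
    connectiveConstant x.1 x.2 ≤ ENNReal.ofReal W}

/-- The distance function `D_sup`; the suprema are over `supp φ ∪ supp ψ`. -/
def Dsup {Γ : Type*} (x y : (Γ → ℝ) × (Γ → ℝ)) : ℝ :=
  (⨆ γ : ↥({γ | 0 < x.1 γ} ∪ {γ | 0 < y.1 γ}), |(x.1 γ - y.1 γ) / (x.1 γ + y.1 γ)|) +
    ⨆ γ : ↥({γ | 0 < x.1 γ} ∪ {γ | 0 < y.1 γ}), |(x.2 γ - y.2 γ) / (x.2 γ + y.2 γ)|

/-! Proof that the value of `windowGrowth φ ℓ c` does not depend on `c ≥ 1`. -/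

section WellDefined

variable {Γ : Type*} [Group Γ]

lemma totalWeight_mono (φ : Γ → ℝ) {P Q : Set (SAW Γ)} (hPQ : P ⊆ Q) :
    totalWeight φ P ≤ totalWeight φ Q :=
  ENNReal.tsum_mono_subtype (fun π : SAW Γ => ENNReal.ofReal (π.weight φ)) hPQ

lemma windowGrowth_mono (φ ℓ : Γ → ℝ) {c d : ℝ} (hcd : c ≤ d) :
    windowGrowth φ ℓ c ≤ windowGrowth φ ℓ d := by
  refine limsup_le_limsup (Eventually.of_forall fun m => ?_)
  refine ENNReal.rpow_le_rpow (totalWeight_mono φ ?_) (by positivity)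
  rintro π ⟨h0, h1, h2⟩
  exact ⟨h0, h1, by linarith⟩

lemma totalWeight_window_le (φ ℓ : Γ → ℝ) (m k : ℕ) :
    totalWeight φ (sawWindow ℓ m k) ≤
      ∑ i ∈ Finset.range k, totalWeight φ (sawWindow ℓ ((m + i : ℕ) : ℝ) 1) := by
  have hsub : sawWindow ℓ (m : ℝ) k ⊆
      ⋃ i ∈ Finset.range k, sawWindow (Γ := Γ) ℓ ((m + i : ℕ) : ℝ) 1 := by
    rintro π ⟨h0, h1, h2⟩
    have hnn : 0 ≤ π.length ℓ := le_trans (Nat.cast_nonneg m) h1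
    have hf := Nat.floor_le hnn
    have hl := Nat.lt_floor_add_one (π.length ℓ)
    have hm : m ≤ ⌊π.length ℓ⌋₊ := Nat.le_floor h1
    have hk : ⌊π.length ℓ⌋₊ < m + k := by
      rw [Nat.floor_lt hnn]; push_cast; exact h2
    simp only [Set.mem_iUnion, Finset.mem_range]
    refine ⟨⌊π.length ℓ⌋₊ - m, by omega, h0, ?_, ?_⟩
    · rw [Nat.add_sub_cancel' hm]; exact hf
    · rw [Nat.add_sub_cancel' hm]; exact hl
  refine (totalWeight_mono φ hsub).trans ?_
  exact ENNReal.tsum_biUnion_le (fun π : SAW Γ => ENNReal.ofReal (π.weight φ)) _ _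

lemma windowGrowth_natCast_le (φ ℓ : Γ → ℝ) (k : ℕ) :
    windowGrowth φ ℓ k ≤ windowGrowth φ ℓ 1 := by
  refine le_of_forall_gt_imp_ge_of_dense fun M hM => ?_
  rcases eq_or_ne M ⊤ with rfl | hMtop
  · exact le_top
  have hM0 : M ≠ 0 := (bot_le.trans_lt hM).ne'
  have hev : ∀ᶠ m : ℕ in atTop, totalWeight φ (sawWindow ℓ (m : ℝ) 1) ≤ M ^ m := by
    filter_upwards [eventually_lt_of_limsup_lt hM, eventually_gt_atTop 0] with m hm hm0
    have h1 := ENNReal.rpow_le_rpow hm.le (Nat.cast_nonneg (α := ℝ) m)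
    rwa [← ENNReal.rpow_mul, one_div_mul_cancel (by positivity), ENNReal.rpow_one,
      ENNReal.rpow_natCast] at h1
  obtain ⟨N, hN⟩ := eventually_atTop.1 hev
  set K : ENNReal := ∑ i ∈ Finset.range k, M ^ i + 1 with hK
  have hK0 : K ≠ 0 := by simp [hK]
  have hKtop : K ≠ ⊤ := by
    simp only [hK, ne_eq, ENNReal.add_eq_top, ENNReal.sum_eq_top, ENNReal.one_ne_top, or_false]
    rintro ⟨i, -, hi⟩
    exact ENNReal.pow_ne_top hMtop hi
  have hbound : ∀ᶠ m : ℕ in atTop,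
      totalWeight φ (sawWindow ℓ (m : ℝ) k) ^ (1 / (m : ℝ)) ≤ M * K ^ (1 / (m : ℝ)) := by
    filter_upwards [eventually_ge_atTop N, eventually_gt_atTop 0] with m hm hm0
    have h1 : totalWeight φ (sawWindow ℓ (m : ℝ) k) ≤ M ^ m * K := by
      refine (totalWeight_window_le φ ℓ m k).trans ?_
      calc ∑ i ∈ Finset.range k, totalWeight φ (sawWindow ℓ ((m + i : ℕ) : ℝ) 1)
          ≤ ∑ i ∈ Finset.range k, M ^ (m + i) :=
            Finset.sum_le_sum fun i _ => hN (m + i) (by omega)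
        _ = M ^ m * ∑ i ∈ Finset.range k, M ^ i := by
            simp [pow_add, Finset.mul_sum]
        _ ≤ M ^ m * K := by gcongr; exact le_self_add
    refine (ENNReal.rpow_le_rpow h1 (by positivity)).trans_eq ?_
    rw [ENNReal.mul_rpow_of_nonneg _ _ (by positivity), ← ENNReal.rpow_natCast,
      ← ENNReal.rpow_mul, mul_one_div_cancel (by positivity), ENNReal.rpow_one]
  have hlim : Tendsto (fun m : ℕ => M * K ^ (1 / (m : ℝ))) atTop (nhds M) := by
    have h1 : Tendsto (fun m : ℕ => K ^ (1 / (m : ℝ))) atTop (nhds 1) := by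
      have h2 : Tendsto (fun m : ℕ => (K.toNNReal : NNReal) ^ (1 / (m : ℝ))) atTop (nhds 1) := by
        have h3 := (NNReal.continuousAt_rpow (x := K.toNNReal) (y := (0 : ℝ))
          (Or.inl (ENNReal.toNNReal_ne_zero.2 ⟨hK0, hKtop⟩))).tendsto
        have h4 : Tendsto (fun m : ℕ => (K.toNNReal, 1 / (m : ℝ))) atTop
            (nhds (K.toNNReal, (0 : ℝ))) :=
          tendsto_const_nhds.prodMk_nhds tendsto_one_div_atTop_nhds_zero_nat
        simpa [Function.comp_def] using h3.comp h4
      have h5 := ENNReal.tendsto_coe.2 h2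
      refine h5.congr fun m => ?_
      rw [ENNReal.coe_rpow_of_nonneg _ (by positivity), ENNReal.coe_toNNReal hKtop]
    simpa using ENNReal.Tendsto.const_mul h1 (Or.inl one_ne_zero)
  calc windowGrowth φ ℓ k ≤ limsup (fun m : ℕ => M * K ^ (1 / (m : ℝ))) atTop :=
        limsup_le_limsup hbound
    _ = M := hlim.limsup_eq

lemma windowGrowth_eq_one (φ ℓ : Γ → ℝ) {c : ℝ} (hc : 1 ≤ c) :
    windowGrowth φ ℓ c = windowGrowth φ ℓ 1 :=
  le_antisymm
    ((windowGrowth_mono φ ℓ (Nat.le_ceil c)).trans (windowGrowth_natCast_le φ ℓ ⌈c⌉₊))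
    (windowGrowth_mono φ ℓ hc)

/-- For every `c ≥ 1`, the quantity `windowGrowth φ ℓ c` is the connective constant. -/
theorem windowGrowth_eq_connectiveConstant (φ ℓ : Γ → ℝ) {c : ℝ} (hc : 1 ≤ c) :
    windowGrowth φ ℓ c = connectiveConstant φ ℓ := by
  rw [windowGrowth_eq_one φ ℓ hc, connectiveConstant]
  have h : (fun c : ℝ => windowGrowth φ ℓ c) =ᶠ[atTop] fun _ => windowGrowth φ ℓ 1 := by
    filter_upwards [eventually_ge_atTop 1] with d hd using windowGrowth_eq_one φ ℓ hd
  rw [limsup_congr h, limsup_const]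

end WellDefined

end WeightedSAW

end

namespace WeightedSAW

open Filter

/-! ### Generating function of weighted self-avoiding walks and its critical point -/

section GeneratingFunction

variable {Γ : Type*} [Group Γ]

/-! The connective constant is the critical value of the generating function `∑ w_φ(π) r ^ (-ℓ(π))`:
its tail over long walks converges for `r > μ`, and convergence at `r` forces `μ ≤ r`
(`exists_tailSeries_ne_top`, `connectiveConstant_le_of_tailSeries_ne_top`). Bounds on `μ` can thus
be carried from one pair to another by comparing the two series walk by walk.

If `D_sup` is small, weights and lengths agree on the supports up to a factor `t` near `1`
(`comparable_of_Dsup_lt`). A walk with `n` steps then changes weight by at most `t ^ n`. Steps have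
length bounded below, so `n` is at most a constant times the length, and `t ^ n` is absorbed by a
slight increase of the base `r`. The change of length only perturbs the exponent by a factor in
`[1/t, t]`. Hence a bound `M` for one pair gives `comparisonBound a M t` for the other
(`connectiveConstant_le_comparisonBound`), which tends to `M` as `t → 1`. Applying this in both
directions gives the two halves of continuity. -/

/-- The set of SAWs from the identity with `ℓ`-length at least `N`. -/
def sawTail (ℓ : Γ → ℝ) (N : ℝ) : Set (SAW Γ) :=
  {π | π.vertex 0 = 1 ∧ N ≤ π.length ℓ}

/-- The tail `∑ w_φ(π) r ^ (-ℓ(π))`, over SAWs with `ℓ(π) ≥ N`, of the generating function of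
weighted SAWs from the identity. -/
noncomputable def tailSeries (φ ℓ : Γ → ℝ) (r N : ℝ) : ENNReal :=
  ∑' π : sawTail ℓ N, ENNReal.ofReal (π.1.weight φ * r ^ (-π.1.length ℓ))

lemma SAW.weight_nonneg {φ : Γ → ℝ} (hφ : ∀ γ, 0 ≤ φ γ) (π : SAW Γ) : 0 ≤ π.weight φ :=
  Finset.prod_nonneg fun _ _ => hφ _

/-- On `[k, k + 1]`, the function `x ↦ r ^ x` is at most a constant multiple of `r ^ k`. -/
lemma rpow_le_max_mul_pow {r x : ℝ} {k : ℕ} (hr : 0 < r) (h1 : k ≤ x) (h2 : x ≤ k + 1) :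
    r ^ x ≤ max 1 r * r ^ k := by
  have hx : r ^ x = r ^ (x - k) * r ^ k := by
    rw [← Real.rpow_natCast, ← Real.rpow_add hr]; ring_nf
  rw [hx]
  gcongr
  rcases le_total 1 r with h | h
  · refine le_max_of_le_right ?_
    calc r ^ (x - k) ≤ r ^ (1 : ℝ) := Real.rpow_le_rpow_of_exponent_le h (by linarith)
      _ = r := Real.rpow_one r
  · exact le_max_of_le_left (Real.rpow_le_one hr.le h (by linarith))

/-- Beyond the connective constant, the generating function has a finite tail. -/
lemma exists_tailSeries_ne_top {φ ℓ : Γ → ℝ} (hφ : ∀ γ, 0 ≤ φ γ) {r : ℝ} (hr : 0 < r)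
    (hμ : connectiveConstant φ ℓ < ENNReal.ofReal r) :
    ∃ N : ℕ, tailSeries φ ℓ r N ≠ ⊤ := by
  -- With `μ < s < r`, the unit window at `k` contributes at most a constant times `(s / r) ^ k`, so
  -- the tail is dominated by a geometric series.
  obtain ⟨s, hs1, hs2⟩ := ENNReal.lt_iff_exists_nnreal_btwn.1 hμ
  have hsr : (s : ℝ) < r := by
    rwa [ENNReal.ofReal, ENNReal.coe_lt_coe, Real.lt_toNNReal_iff_coe_lt] at hs2
  rw [← windowGrowth_eq_connectiveConstant φ ℓ le_rfl] at hs1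
  have hev : ∀ᶠ m : ℕ in atTop, totalWeight φ (sawWindow ℓ (m : ℝ) 1) ≤ (s : ENNReal) ^ m := by
    filter_upwards [eventually_lt_of_limsup_lt hs1, eventually_gt_atTop 0] with m hm hm0
    have h1 := ENNReal.rpow_le_rpow hm.le (Nat.cast_nonneg (α := ℝ) m)
    rwa [← ENNReal.rpow_mul, one_div_mul_cancel (by positivity), ENNReal.rpow_one,
      ENNReal.rpow_natCast] at h1
  obtain ⟨N, hN⟩ := eventually_atTop.1 hev
  refine ⟨N, ?_⟩
  set f : SAW Γ → ENNReal := fun π => ENNReal.ofReal (π.weight φ * r ^ (-π.length ℓ)) with hf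
  have hsub : sawTail ℓ (N : ℝ) ⊆ ⋃ j : ℕ, sawWindow (Γ := Γ) ℓ ((N + j : ℕ) : ℝ) 1 := by
    rintro π ⟨h0, h1⟩
    have hnn : 0 ≤ π.length ℓ := le_trans (Nat.cast_nonneg N) h1
    refine Set.mem_iUnion.2 ⟨⌊π.length ℓ⌋₊ - N, h0, ?_⟩
    rw [Nat.add_sub_cancel' (Nat.le_floor h1)]
    exact ⟨Nat.floor_le hnn, Nat.lt_floor_add_one _⟩
  have hwin : ∀ k : ℕ, N ≤ k → ∑' π : sawWindow (Γ := Γ) ℓ (k : ℝ) 1, f π ≤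
      ENNReal.ofReal (max 1 r⁻¹ * (r⁻¹ * s) ^ k) := by
    intro k hk
    have hterm : ∀ π : sawWindow (Γ := Γ) ℓ (k : ℝ) 1,
        f π ≤ ENNReal.ofReal (max 1 r⁻¹ * r⁻¹ ^ k) * ENNReal.ofReal (π.1.weight φ) := by
      rintro ⟨π, -, h1, h2⟩
      rw [← ENNReal.ofReal_mul (by positivity), mul_comm _ (π.weight φ)]
      refine ENNReal.ofReal_le_ofReal (mul_le_mul_of_nonneg_left ?_ (π.weight_nonneg hφ))
      rw [Real.rpow_neg hr.le, ← Real.inv_rpow hr.le]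
      exact rpow_le_max_mul_pow (inv_pos.2 hr) h1 h2.le
    refine (ENNReal.tsum_le_tsum hterm).trans ?_
    rw [ENNReal.tsum_mul_left]
    calc _ ≤ ENNReal.ofReal (max 1 r⁻¹ * r⁻¹ ^ k) * (s : ENNReal) ^ k := by
          gcongr; exact hN k hk
      _ = _ := by
          rw [← ENNReal.ofReal_coe_nnreal, ← ENNReal.ofReal_pow s.coe_nonneg,
            ← ENNReal.ofReal_mul (by positivity), mul_pow, mul_assoc]
  have hq0 : 0 ≤ r⁻¹ * (s : ℝ) := by positivity
  have hq1 : r⁻¹ * (s : ℝ) < 1 := by rwa [inv_mul_lt_iff₀ hr, mul_one]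
  have hsum : Summable fun j : ℕ => max 1 r⁻¹ * (r⁻¹ * (s : ℝ)) ^ (N + j) :=
    (((summable_geometric_of_lt_one hq0 hq1).mul_left _).mul_left (max 1 r⁻¹)).congr
      fun j => by rw [pow_add]
  refine ne_top_of_le_ne_top hsum.tsum_ofReal_ne_top ?_
  calc tailSeries φ ℓ r N ≤ ∑' π : ⋃ j : ℕ, sawWindow (Γ := Γ) ℓ ((N + j : ℕ) : ℝ) 1, f π :=
        ENNReal.tsum_mono_subtype f hsub
    _ ≤ ∑' j : ℕ, ∑' π : sawWindow (Γ := Γ) ℓ ((N + j : ℕ) : ℝ) 1, f π :=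
        ENNReal.tsum_iUnion_le_tsum f _
    _ ≤ _ := ENNReal.tsum_le_tsum fun j => hwin (N + j) (Nat.le_add_right N j)

/-- If the generating function has a finite tail at `r`, the connective constant is at most `r`. -/
lemma connectiveConstant_le_of_tailSeries_ne_top {φ ℓ : Γ → ℝ} (hφ : ∀ γ, 0 ≤ φ γ) {r N : ℝ}
    (hr : 0 < r) (h : tailSeries φ ℓ r N ≠ ⊤) :
    connectiveConstant φ ℓ ≤ ENNReal.ofReal r := by
  rw [← windowGrowth_eq_connectiveConstant φ ℓ le_rfl]
  -- The `+ 1` keeps `K` nonzero even if the tail vanishes, so that `K ^ (1 / m) → 1`.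
  set K : ℝ := max 1 r * ((tailSeries φ ℓ r N).toReal + 1) with hK
  have hK0 : 0 < K := by positivity
  have hbound : ∀ᶠ m : ℕ in atTop, totalWeight φ (sawWindow ℓ (m : ℝ) 1) ^ (1 / (m : ℝ)) ≤
      ENNReal.ofReal (K ^ (1 / (m : ℝ)) * r) := by
    filter_upwards [eventually_ge_atTop ⌈N⌉₊, eventually_gt_atTop 0] with m hm hm0
    have hmN : N ≤ m := Nat.ceil_le.1 hm
    have htotal : totalWeight φ (sawWindow ℓ (m : ℝ) 1) ≤ ENNReal.ofReal (K * r ^ m) := by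
      have hterm : ∀ π : sawWindow (Γ := Γ) ℓ (m : ℝ) 1, ENNReal.ofReal (π.1.weight φ) ≤
          ENNReal.ofReal (max 1 r * r ^ m) *
            ENNReal.ofReal (π.1.weight φ * r ^ (-π.1.length ℓ)) := by
        rintro ⟨π, -, h1, h2⟩
        rw [← ENNReal.ofReal_mul (by positivity)]
        refine ENNReal.ofReal_le_ofReal ?_
        have hpow : 0 < r ^ π.length ℓ := Real.rpow_pos_of_pos hr _
        calc π.weight φ = r ^ π.length ℓ * (π.weight φ * r ^ (-π.length ℓ)) := by
              rw [Real.rpow_neg hr.le]; field_simp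
          _ ≤ max 1 r * r ^ m * (π.weight φ * r ^ (-π.length ℓ)) := by
              refine mul_le_mul_of_nonneg_right (rpow_le_max_mul_pow hr h1 h2.le) ?_
              exact mul_nonneg (π.weight_nonneg hφ) (Real.rpow_nonneg hr.le _)
      calc totalWeight φ (sawWindow ℓ (m : ℝ) 1)
          ≤ ENNReal.ofReal (max 1 r * r ^ m) * ∑' π : sawWindow (Γ := Γ) ℓ (m : ℝ) 1,
              ENNReal.ofReal (π.1.weight φ * r ^ (-π.1.length ℓ)) := by
            rw [← ENNReal.tsum_mul_left]; exact ENNReal.tsum_le_tsum hterm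
        _ ≤ ENNReal.ofReal (max 1 r * r ^ m) * tailSeries φ ℓ r N := by
            gcongr
            exact ENNReal.tsum_mono_subtype
              (fun π : SAW Γ => ENNReal.ofReal (π.weight φ * r ^ (-π.length ℓ)))
              fun π hπ => ⟨hπ.1, hmN.trans hπ.2.1⟩
        _ ≤ ENNReal.ofReal (max 1 r * r ^ m) *
              ENNReal.ofReal ((tailSeries φ ℓ r N).toReal + 1) := by
            gcongr
            rw [ENNReal.le_ofReal_iff_toReal_le h (by positivity)]
            linarith
        _ = ENNReal.ofReal (K * r ^ m) := by
            rw [← ENNReal.ofReal_mul (by positivity), hK]; ring_nf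
    refine (ENNReal.rpow_le_rpow htotal (by positivity)).trans_eq ?_
    rw [ENNReal.ofReal_rpow_of_nonneg (by positivity) (by positivity),
      Real.mul_rpow hK0.le (by positivity), ← Real.rpow_natCast r m, ← Real.rpow_mul hr.le,
      mul_one_div_cancel (by positivity), Real.rpow_one]
  have hlim : Tendsto (fun m : ℕ => ENNReal.ofReal (K ^ (1 / (m : ℝ)) * r)) atTop
      (nhds (ENNReal.ofReal r)) := by
    refine ENNReal.tendsto_ofReal ?_
    have h1 : Tendsto (fun m : ℕ => K ^ (1 / (m : ℝ))) atTop (nhds (K ^ (0 : ℝ))) :=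
      (Real.continuousAt_const_rpow hK0.ne').tendsto.comp tendsto_one_div_atTop_nhds_zero_nat
    simpa using h1.mul_const r
  exact (limsup_le_limsup hbound).trans_eq hlim.limsup_eq

end GeneratingFunction

/-! ### Comparison of the connective constants of two nearby pairs -/

section Comparison

variable {Γ : Type*} [Group Γ]

/-- The bound for the connective constant of a pair `(ψ, ℓ')` obtained from a bound `M` for that
of `(φ, ℓ)`, when the functions agree up to a factor `t` and the lengths are at least `a / t`. -/
noncomputable def comparisonBound (a M t : ℝ) : ℝ :=
  max ((t ^ (t / a) * M) ^ t) ((t ^ (t / a) * M) ^ t⁻¹)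

lemma comparisonBound_pos {a M t : ℝ} (hM : 0 < M) (ht : 0 < t) : 0 < comparisonBound a M t :=
  lt_max_of_lt_left (by positivity)

lemma tendsto_comparisonBound (a : ℝ) {M : ℝ} (hM : 0 < M) :
    Tendsto (comparisonBound a M) (nhds 1) (nhds M) := by
  have hb : ContinuousAt (fun t : ℝ => t ^ (t / a) * M) 1 :=
    (continuousAt_id.rpow (continuousAt_id.div_const a) (Or.inl one_ne_zero)).mul
      continuousAt_const
  have hne : (1 : ℝ) ^ (1 / a) * M ≠ 0 := by simpa using hM.ne'
  have hcont : ContinuousAt (comparisonBound a M) 1 :=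
    (hb.rpow continuousAt_id (Or.inl hne)).max
      (hb.rpow (continuousAt_inv₀ one_ne_zero) (Or.inl hne))
  simpa [ContinuousAt, comparisonBound] using hcont

/-- A power of `b` with exponent in `[x / t, t * x]` is at most the `x`-th power of the larger of
`b ^ t` and `b ^ t⁻¹`. -/
lemma rpow_le_max_rpow {b t x y : ℝ} (hb : 0 < b) (hx : 0 ≤ x) (hxy : x ≤ t * y)
    (hyx : y ≤ t * x) (ht : 0 < t) : b ^ y ≤ max (b ^ t) (b ^ t⁻¹) ^ x := by
  rcases le_total 1 b with h | h
  · calc b ^ y ≤ b ^ (t * x) := Real.rpow_le_rpow_of_exponent_le h hyx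
      _ = (b ^ t) ^ x := Real.rpow_mul hb.le _ _
      _ ≤ _ := Real.rpow_le_rpow (by positivity) (le_max_left _ _) hx
  · calc b ^ y ≤ b ^ (t⁻¹ * x) :=
          Real.rpow_le_rpow_of_exponent_ge hb h ((inv_mul_le_iff₀ ht).2 hxy)
      _ = (b ^ t⁻¹) ^ x := Real.rpow_mul hb.le _ _
      _ ≤ _ := Real.rpow_le_rpow (by positivity) (le_max_right _ _) hx

/-- The tail series of `(ψ, ℓ')` at the comparison bound is dominated term by term by that of `(φ,
ℓ)` at `M`. Comparability is needed only on the support of `ψ`, since every other walk has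
`ψ`-weight zero. The lower bound is `a / t` rather than `a` so that the lemma applies in both
directions with the same `a`. -/
lemma connectiveConstant_le_comparisonBound {φ ψ ℓ ℓ' : Γ → ℝ} (hφ : ∀ γ, 0 ≤ φ γ)
    (hψ : ∀ γ, 0 ≤ ψ γ) {a t M : ℝ} (ha : 0 < a) (ht : 1 ≤ t) (hM : 0 < M)
    (hweight : ∀ γ, 0 < ψ γ → ψ γ ≤ t * φ γ) (hlower : ∀ γ, 0 < ψ γ → a ≤ t * ℓ γ)
    (hle : ∀ γ, 0 < ψ γ → ℓ γ ≤ t * ℓ' γ) (hge : ∀ γ, 0 < ψ γ → ℓ' γ ≤ t * ℓ γ)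
    (hμ : connectiveConstant φ ℓ < ENNReal.ofReal M) :
    connectiveConstant ψ ℓ' ≤ ENNReal.ofReal (comparisonBound a M t) := by
  have ht0 : 0 < t := one_pos.trans_le ht
  obtain ⟨N, hN⟩ := exists_tailSeries_ne_top hφ hM hμ
  have hB := comparisonBound_pos (a := a) hM ht0
  -- The threshold `t * N` ensures that `ℓ'`-long walks of positive weight have `ℓ`-length at least
  -- `N`.
  refine connectiveConstant_le_of_tailSeries_ne_top hψ (N := t * N) hB
    (ne_top_of_le_ne_top hN ?_)
  -- The two tails are different sets of walks; indicators put both sums over all walks.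
  rw [tailSeries, tailSeries, tsum_subtype (sawTail ℓ' (t * N)) fun π : SAW Γ =>
      ENNReal.ofReal (π.weight ψ * comparisonBound a M t ^ (-π.length ℓ')),
    tsum_subtype (sawTail ℓ (N : ℝ)) fun π : SAW Γ =>
      ENNReal.ofReal (π.weight φ * M ^ (-π.length ℓ))]
  refine ENNReal.tsum_le_tsum fun π => ?_
  by_cases hπ : π ∈ sawTail ℓ' (t * N)
  swap
  · simp [hπ]
  rw [Set.indicator_of_mem hπ]
  by_cases hpos : ∀ i, 0 < ψ (π.increment i)
  swap
  · have : π.weight ψ = 0 := by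
      push Not at hpos
      obtain ⟨i, hi⟩ := hpos
      exact Finset.prod_eq_zero (Finset.mem_univ i) (le_antisymm hi (hψ _))
    simp [this]
  have h1 : π.length ℓ ≤ t * π.length ℓ' := by
    rw [SAW.length, SAW.length, Finset.mul_sum]
    exact Finset.sum_le_sum fun i _ => hle _ (hpos i)
  have h2 : π.length ℓ' ≤ t * π.length ℓ := by
    rw [SAW.length, SAW.length, Finset.mul_sum]
    exact Finset.sum_le_sum fun i _ => hge _ (hpos i)
  have h3 : π.weight ψ ≤ t ^ π.steps * π.weight φ := by
    calc π.weight ψ ≤ ∏ i, t * φ (π.increment i) :=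
          Finset.prod_le_prod (fun i _ => hψ _) fun i _ => hweight _ (hpos i)
      _ = _ := by simp [SAW.weight, Finset.prod_mul_distrib]
  -- Every step has `ℓ`-length at least `a / t`, so length controls the number of steps.
  have h4 : (π.steps : ℝ) ≤ t / a * π.length ℓ := by
    have : ∑ _i : Fin π.steps, a ≤ t * π.length ℓ := by
      rw [SAW.length, Finset.mul_sum]
      exact Finset.sum_le_sum fun i _ => hlower _ (hpos i)
    rw [Finset.sum_const, Finset.card_univ, Fintype.card_fin, nsmul_eq_mul] at this
    rwa [div_mul_eq_mul_div, le_div_iff₀ ha]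
  have hmem : π ∈ sawTail ℓ (N : ℝ) :=
    ⟨hπ.1, le_of_mul_le_mul_left (hπ.2.trans h2) ht0⟩
  rw [Set.indicator_of_mem hmem]
  refine ENNReal.ofReal_le_ofReal ?_
  have hlen : 0 ≤ π.length ℓ' := le_trans (by positivity) hπ.2
  have hkey : (t ^ (t / a) * M) ^ π.length ℓ ≤ comparisonBound a M t ^ π.length ℓ' :=
    rpow_le_max_rpow (by positivity) hlen h2 h1 ht0
  have hsteps : t ^ π.steps ≤ (t ^ (t / a)) ^ π.length ℓ := by
    rw [← Real.rpow_natCast, ← Real.rpow_mul ht0.le]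
    exact Real.rpow_le_rpow_of_exponent_le ht h4
  rw [Real.mul_rpow (by positivity) hM.le] at hkey
  rw [Real.rpow_neg hB.le, Real.rpow_neg hM.le, ← div_eq_mul_inv, ← div_eq_mul_inv,
    div_le_div_iff₀ (Real.rpow_pos_of_pos hB _) (Real.rpow_pos_of_pos hM _)]
  have hw := π.weight_nonneg hφ
  have hMp : 0 ≤ M ^ π.length ℓ := Real.rpow_nonneg hM.le _
  calc π.weight ψ * M ^ π.length ℓ
      ≤ (t ^ (t / a)) ^ π.length ℓ * π.weight φ * M ^ π.length ℓ := by
        gcongr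
        exact h3.trans (by gcongr)
    _ = π.weight φ * ((t ^ (t / a)) ^ π.length ℓ * M ^ π.length ℓ) := by ring
    _ ≤ _ := by gcongr

end Comparison

/-! ### From `Dsup` to multiplicative comparability -/

section Distance

/-- A symmetric relative difference less than `(t - 1) / (t + 1)` means a ratio of at most `t`. -/
lemma le_mul_of_abs_div_add_lt {p q t : ℝ} (hpq : 0 < p + q) (ht : 1 < t)
    (h : |(p - q) / (p + q)| < (t - 1) / (t + 1)) : p ≤ t * q ∧ q ≤ t * p := by
  rw [abs_div, abs_of_pos hpq, div_lt_div_iff₀ hpq (by linarith)] at h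
  have h1 := le_abs_self (p - q)
  have h2 := neg_abs_le (p - q)
  constructor <;> nlinarith

lemma abs_sub_div_add_le_one {p q : ℝ} (hp : 0 ≤ p) (hq : 0 ≤ q) :
    |(p - q) / (p + q)| ≤ 1 := by
  rw [abs_div, abs_of_nonneg (add_nonneg hp hq)]
  refine div_le_one_of_le₀ (abs_le.2 ⟨?_, ?_⟩) (add_nonneg hp hq) <;> linarith

variable {Γ : Type*}

/-- Pairs at small `Dsup` distance agree up to a factor close to `1` on their supports. -/
lemma comparable_of_Dsup_lt {x y : (Γ → ℝ) × (Γ → ℝ)} (hx1 : ∀ γ, 0 ≤ x.1 γ)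
    (hy1 : ∀ γ, 0 ≤ y.1 γ) (hx2 : ∀ γ, 0 < x.2 γ) (hy2 : ∀ γ, 0 < y.2 γ) {t : ℝ} (ht : 1 < t)
    (hD : Dsup x y < (t - 1) / (t + 1)) {γ : Γ} (hγ : 0 < x.1 γ ∨ 0 < y.1 γ) :
    (x.1 γ ≤ t * y.1 γ ∧ y.1 γ ≤ t * x.1 γ) ∧ (x.2 γ ≤ t * y.2 γ ∧ y.2 γ ≤ t * x.2 γ) := by
  let S : Set Γ := {γ | 0 < x.1 γ} ∪ {γ | 0 < y.1 γ}
  -- Boundedness is essential: an unbounded real supremum would take the default value `0` and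
  -- control nothing.
  have hbdd1 : BddAbove (Set.range fun γ : S => |(x.1 γ - y.1 γ) / (x.1 γ + y.1 γ)|) :=
    ⟨1, by rintro _ ⟨γ, rfl⟩; exact abs_sub_div_add_le_one (hx1 _) (hy1 _)⟩
  have hbdd2 : BddAbove (Set.range fun γ : S => |(x.2 γ - y.2 γ) / (x.2 γ + y.2 γ)|) :=
    ⟨1, by rintro _ ⟨γ, rfl⟩; exact abs_sub_div_add_le_one (hx2 _).le (hy2 _).le⟩
  have h1 := le_ciSup hbdd1 (⟨γ, hγ⟩ : S)
  have h2 := le_ciSup hbdd2 (⟨γ, hγ⟩ : S)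
  have h3 : 0 ≤ ⨆ γ : S, |(x.1 γ - y.1 γ) / (x.1 γ + y.1 γ)| :=
    Real.iSup_nonneg fun _ => abs_nonneg _
  have h4 : 0 ≤ ⨆ γ : S, |(x.2 γ - y.2 γ) / (x.2 γ + y.2 γ)| :=
    Real.iSup_nonneg fun _ => abs_nonneg _
  have hD' : (⨆ γ : S, |(x.1 γ - y.1 γ) / (x.1 γ + y.1 γ)|) +
    (⨆ γ : S, |(x.2 γ - y.2 γ) / (x.2 γ + y.2 γ)|) < (t - 1) / (t + 1) := hD
  refine ⟨le_mul_of_abs_div_add_lt ?_ ht (by linarith),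
    le_mul_of_abs_div_add_lt (add_pos (hx2 γ) (hy2 γ)) ht (by linarith)⟩
  rcases hγ with h | h
  · exact add_pos_of_pos_of_nonneg h (hy1 γ)
  · exact add_pos_of_nonneg_of_pos (hx1 γ) h

end Distance

end WeightedSAW

/-! ### The continuity theorem -/

theorem theorem4p1 {Γ : Type*} [Group Γ] [Group.FG Γ]
    (H : Subgroup Γ) (F : H →* Multiplicative ℤ)
    (hHF : WeightedSAW.IsVirtuallyIndicable H F)
    (h : (Γ → ℝ) → Γ → ℤ)
    (hh : ∀ φ : Γ → ℝ, WeightedSAW.IsWeightFunction φ →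
      WeightedSAW.IsStrongGraphHeight φ H (h φ))
    (C W ε : ℝ) (hC : 0 < C) (hW : 0 < W) (hε : ε ∈ Set.Ico (1 : ℝ) 2) :
    ∀ x ∈ WeightedSAW.pairSpace h ε C W, ∀ ρ : ℝ, 0 < ρ →
      ∃ δ : ℝ, 0 < δ ∧ ∀ y ∈ WeightedSAW.pairSpace h ε C W, WeightedSAW.Dsup x y < δ →
        |(WeightedSAW.connectiveConstant x.1 x.2).toReal -
          (WeightedSAW.connectiveConstant y.1 y.2).toReal| < ρ := by
  open WeightedSAW in
  rintro x ⟨hx1, ⟨hx2, -⟩, hxW⟩ ρ hρ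
  have hxtop : connectiveConstant x.1 x.2 ≠ ⊤ := ne_top_of_le_ne_top ENNReal.ofReal_ne_top hxW
  set μ : ℝ := (connectiveConstant x.1 x.2).toReal with hμ
  have hμ0 : 0 ≤ μ := ENNReal.toReal_nonneg
  set a : ℝ := ⨅ γ, x.2 γ with ha
  have ha0 : 0 < a := hx2.iInf_pos
  have hale : ∀ γ, a ≤ x.2 γ :=
    ciInf_le ⟨0, by rintro _ ⟨γ, rfl⟩; exact (hx2.pos γ).le⟩
  have hupper : ∀ᶠ t in nhds (1 : ℝ), comparisonBound a (μ + ρ / 2) t < μ + ρ :=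
    (tendsto_comparisonBound a (by positivity)).eventually_lt_const (by linarith)
  -- The condition `ρ ≤ μ` makes the base `μ - ρ / 2` positive; if `μ < ρ`, the lower estimate is
  -- trivial because connective constants are nonnegative.
  have hlower : ∀ᶠ t in nhds (1 : ℝ), ρ ≤ μ → comparisonBound a (μ - ρ / 2) t < μ := by
    by_cases hρμ : ρ ≤ μ
    · filter_upwards [(tendsto_comparisonBound a
        (show 0 < μ - ρ / 2 by linarith)).eventually_lt_const (show μ - ρ / 2 < μ by linarith)]
        with t ht _ using ht
    · exact Eventually.of_forall fun t ht => absurd ht hρμ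
  obtain ⟨t, ⟨htu, htl⟩, ht⟩ : ∃ t : ℝ, (comparisonBound a (μ + ρ / 2) t < μ + ρ ∧
      (ρ ≤ μ → comparisonBound a (μ - ρ / 2) t < μ)) ∧ 1 < t :=
    (((hupper.and hlower).filter_mono nhdsWithin_le_nhds).and
      (self_mem_nhdsWithin : Set.Ioi (1 : ℝ) ∈ nhdsWithin 1 (Set.Ioi 1))).exists
  have ht0 : 0 < t := by linarith
  -- This is the relative difference `(p - q) / (p + q)` of two numbers in ratio exactly `t`.
  refine ⟨(t - 1) / (t + 1), div_pos (by linarith) (by linarith), ?_⟩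
  rintro y ⟨hy1, ⟨hy2, -⟩, hyW⟩ hD
  have hytop : connectiveConstant y.1 y.2 ≠ ⊤ := ne_top_of_le_ne_top ENNReal.ofReal_ne_top hyW
  have hcmp := fun γ => comparable_of_Dsup_lt (γ := γ) hx1.nonneg hy1.nonneg hx2.pos hy2.pos ht hD
  have hy : (connectiveConstant y.1 y.2).toReal < μ + ρ := by
    refine lt_of_le_of_lt (ENNReal.toReal_le_of_le_ofReal
      (comparisonBound_pos (by positivity) ht0).le
      (connectiveConstant_le_comparisonBound hx1.nonneg hy1.nonneg ha0 ht.le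
      (show 0 < μ + ρ / 2 by positivity) (fun γ hγ => (hcmp γ (Or.inr hγ)).1.2)
      (fun γ _ => ?_) (fun γ hγ => (hcmp γ (Or.inr hγ)).2.1)
      (fun γ hγ => (hcmp γ (Or.inr hγ)).2.2) ?_)) htu
    · exact (hale γ).trans (le_mul_of_one_le_left (hx2.pos γ).le ht.le)
    · rw [ENNReal.lt_ofReal_iff_toReal_lt hxtop]; linarith
  have hx : μ - ρ < (connectiveConstant y.1 y.2).toReal := by
    -- If the constant of `y` were at most `μ - ρ`, it would lie below `μ - ρ / 2`, and comparison
    -- from `y` to `x` would give `μ < μ`. The lengths of `y` inherit the lower bound `a / t` from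
    -- those of `x` on the support of `x.1`, so the choice of `t` does not depend on `y`.
    by_contra! hle
    have hρμ : ρ ≤ μ := by linarith [ENNReal.toReal_nonneg (a := connectiveConstant y.1 y.2)]
    refine (htl hρμ).not_ge (ENNReal.toReal_le_of_le_ofReal
      (comparisonBound_pos (by linarith) ht0).le
      (connectiveConstant_le_comparisonBound hy1.nonneg hx1.nonneg ha0 ht.le
      (show 0 < μ - ρ / 2 by linarith) (fun γ hγ => (hcmp γ (Or.inl hγ)).1.1)
      (fun γ hγ => (hale γ).trans (hcmp γ (Or.inl hγ)).2.1)
      (fun γ hγ => (hcmp γ (Or.inl hγ)).2.2) (fun γ hγ => (hcmp γ (Or.inl hγ)).2.1) ?_))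
    rw [ENNReal.lt_ofReal_iff_toReal_lt hytop]; linarith
  rw [abs_lt]
  constructor <;> linarith
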